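/- A \emph{distance set} is a set $\Delta\subseteq\mathbb{R}_+$ that is either a countable additive subsemigroup $\mathcal S$ of the non-negative reals containing $0$, or an intersection $\mathcal S\cap[0,r]$ of such a semigroup with an interval, where $r\in\mathcal S$. A $\Delta$-metric space is a metric space whose distances all lie in $\Delta$. The Urysohn $\Delta$-metric space $\mathbb{U}_\Delta$ is the (unique up to isometry) countable $\Delta$-metric space that is ultrahomogeneous (every isometry between two finite subsets extends to an isometry of $\mathbb{U}_\Delta$ onto itself) and universal (every countable $\Delta$-metric space embeds isometrically into it). Its isometry group $\mathrm{Isom}(\mathbb{U}_\Delta)$ carries the topology of pointwise convergence, $\mathbb{U}_\Delta$ being regarded as a discrete space. A subset $E$ of a topological group $G$ is \emph{Roelcke precompact} if for every neighbourhood $U$ of the identity there is a finite $F\subseteq G$ with $E\subseteq UFU$; the group $G$ is Roelcke precompact if $E=G$ is, and \emph{locally Roelcke precompact} if it has a non-empty open Roelcke precompact subset. A subset $E\subseteq G$ is \emph{coarsely bounded} if every continuous left-invariant écart (pseudometric) on $G$ assigns a finite diameter to $E$; the group $G$ is coarsely bounded if $E=G$ is, and \emph{locally bounded} if the identity has a coarsely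 bounded neighbourhood. Let $\Delta\subseteq\mathbb{R}_+$ be a distance set. Then: \begin{enumerate} \item $\mathrm{Isom}(\mathbb{U}_\Delta)$ is locally bounded. \item $\mathrm{Isom}(\mathbb{U}_\Delta)$ is coarsely bounded if and only if $\Delta$ is bounded. \item $\mathrm{Isom}(\mathbb{U}_\Delta)$ is locally Roelcke precompact if and only if $\Delta$ is closed in $\mathbb{R}$ and discrete. \item $\mathrm{Isom}(\mathbb{U}_\Delta)$ is Roelcke precompact if and only if $\Delta$ is finite. \end{enumerate} -/

import Mathlib

open Filter Topology Pointwise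

/-! ## Distance sets and Urysohn spaces -/

/-- A *distance set* is either a countable additive subsemigroup `S` of the non-negative reals that
contains `0`, or the intersection `S ∩ [0, r]` of such a semigroup with an interval, `r ∈ S`. -/
def IsDistanceSet (Δ : Set ℝ) : Prop :=
  ∃ S : AddSubmonoid ℝ, (S : Set ℝ).Countable ∧ (∀ s ∈ S, 0 ≤ s) ∧
    (Δ = (S : Set ℝ) ∨ ∃ r ∈ S, Δ = (S : Set ℝ) ∩ Set.Icc 0 r)

/-- A `Δ`-metric space is a metric space all of whose distances lie in `Δ`. -/
def IsDeltaMetric (Δ : Set ℝ) (X : Type*) [MetricSpace X] : Prop :=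
  ∀ x y : X, dist x y ∈ Δ

/-- `X` is the Urysohn `Δ`-metric space `𝕌_Δ`: a countable `Δ`-metric space that is ultrahomogeneous
and universal for countable `Δ`-metric spaces. (Every countable metric space has an isometric copy
in `Type`, so that it does no harm to let `Y` range over `Type` only.) -/
structure IsUrysohnSpace (Δ : Set ℝ) (X : Type*) [MetricSpace X] : Prop where
  countable : Countable X
  isDeltaMetric : IsDeltaMetric Δ X
  ultrahomogeneous : ∀ A B : Set X, A.Finite → B.Finite → ∀ φ : A ≃ᵢ B,
    ∃ g : X ≃ᵢ X, ∀ a : A, g a = φ a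
  universal : ∀ (Y : Type) [MetricSpace Y] [Countable Y], IsDeltaMetric Δ Y →
    ∃ f : Y → X, Isometry f

/-! ## The isometry group with the permutation topology -/

/-- The topology of pointwise convergence on the isometry group of `X`, where `X` is regarded as
a discrete space (and not with its metric topology). -/
instance IsometryEquiv.permutationTopology (X : Type*) [MetricSpace X] :
    TopologicalSpace (X ≃ᵢ X) :=
  TopologicalSpace.induced (fun g : X ≃ᵢ X => (g : X → X))
    (@Pi.topologicalSpace X (fun _ => X) (fun _ => ⊥))

theorem IsometryEquiv.continuous_permutation_iff {X T : Type*} [MetricSpace X] [TopologicalSpace T]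
    (F : T → (X ≃ᵢ X)) :
    Continuous F ↔ ∀ x y : X, IsOpen {t : T | F t x = y} := by
  let _ : TopologicalSpace X := ⊥
  have _ : DiscreteTopology X := ⟨rfl⟩
  have h1 : Continuous F ↔ Continuous (fun t => (F t : X → X)) := continuous_induced_rng
  rw [h1, continuous_pi_iff]
  refine forall_congr' fun x => ?_
  rw [continuous_discrete_rng]
  rfl

theorem IsometryEquiv.isOpen_apply_eq {X : Type*} [MetricSpace X] (x y : X) :
    IsOpen {g : X ≃ᵢ X | g x = y} :=
  (IsometryEquiv.continuous_permutation_iff (T := X ≃ᵢ X) id).1 continuous_id x y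

instance IsometryEquiv.permutation_isTopologicalGroup (X : Type*) [MetricSpace X] :
    IsTopologicalGroup (X ≃ᵢ X) where
  continuous_mul := by
    rw [IsometryEquiv.continuous_permutation_iff]
    intro x y
    have : {t : (X ≃ᵢ X) × (X ≃ᵢ X) | (t.1 * t.2) x = y} =
        ⋃ z : X, {g : X ≃ᵢ X | g z = y} ×ˢ {g : X ≃ᵢ X | g x = z} := by
      ext t
      simp [IsometryEquiv.mul_apply]
    rw [this]
    exact isOpen_iUnion fun z =>
      (IsometryEquiv.isOpen_apply_eq z y).prod (IsometryEquiv.isOpen_apply_eq x z)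
  continuous_inv := by
    rw [IsometryEquiv.continuous_permutation_iff]
    intro x y
    have : {t : X ≃ᵢ X | t⁻¹ x = y} = {t : X ≃ᵢ X | t y = x} := by
      ext t
      constructor
      · rintro rfl
        exact t.apply_inv_self x
      · rintro rfl
        exact t.inv_apply_self y
    rw [this]
    exact IsometryEquiv.isOpen_apply_eq y x

/-! ## Coarse geometry of topological groups -/

section TopologicalGroup

variable (G : Type*) [Group G] [TopologicalSpace G] [IsTopologicalGroup G]

variable {G} in
/-- A subset `E` of `G` is Roelcke precompact if for every neighbourhood `U` of the identity there
is a finite `F ⊆ G` with `E ⊆ U F U`. -/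
def IsRoelckePrecompactSet (E : Set G) : Prop :=
  ∀ U ∈ 𝓝 (1 : G), ∃ F : Set G, F.Finite ∧ E ⊆ U * F * U

/-- `G` is Roelcke precompact. -/
def IsRoelckePrecompactGroup : Prop :=
  IsRoelckePrecompactSet (Set.univ : Set G)

/-- `G` is locally Roelcke precompact: some non-empty open subset is Roelcke precompact. -/
def IsLocallyRoelckePrecompactGroup : Prop :=
  ∃ E : Set G, IsOpen E ∧ E.Nonempty ∧ IsRoelckePrecompactSet E

variable {G} in
/-- A subset `E` of `G` is coarsely bounded if every continuous left-invariant écart (real-valued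
pseudometric) on `G` assigns a finite diameter to `E`. -/
def IsCoarselyBoundedSet (E : Set G) : Prop :=
  ∀ d : PseudoMetric G ℝ, Continuous (fun p : G × G => d p.1 p.2) →
    (∀ g x y : G, d (g * x) (g * y) = d x y) →
    ∃ C : ℝ, ∀ x ∈ E, ∀ y ∈ E, d x y ≤ C

/-- `G` is coarsely bounded. -/
def IsCoarselyBoundedGroup : Prop :=
  IsCoarselyBoundedSet (Set.univ : Set G)

/-- `G` is locally bounded: the identity has a coarsely bounded neighbourhood. -/
def IsLocallyBoundedGroup : Prop :=
  ∃ E ∈ 𝓝 (1 : G), IsCoarselyBoundedSet E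

end TopologicalGroup

/-! ## Existence of the Urysohn space

The rest of this file proves that every distance set has a Urysohn space, so that the notion
defined above is never empty. -/

namespace UrysohnExistence

theorem exists_cap {Δ : Set ℝ} (h : IsDistanceSet Δ) :
    Δ.Countable ∧ (0 : ℝ) ∈ Δ ∧ (∀ a ∈ Δ, 0 ≤ a) ∧ ∃ c : ℝ → ℝ,
      (∀ a ∈ Δ, ∀ b ∈ Δ, c (a + b) ∈ Δ) ∧ (∀ a ∈ Δ, c a = a) ∧
      (∀ u v d, 0 ≤ d → u ≤ v + d → c u ≤ c v + d) ∧
      (∀ a ∈ Δ, ∀ u v, 0 ≤ u → 0 ≤ v → a ≤ u + v → a ≤ c u + c v) := by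
  obtain ⟨S, hc, hp, rfl | ⟨r, hr, rfl⟩⟩ := h
  · exact ⟨hc, S.zero_mem, hp, id, fun a ha b hb => S.add_mem ha hb, fun _ _ => rfl,
      fun _ _ _ _ h => h, fun _ _ _ _ _ _ h => h⟩
  · have hr0 := hp r hr
    refine ⟨hc.mono Set.inter_subset_left, ⟨S.zero_mem, le_rfl, hr0⟩, fun a ha => ha.2.1,
      fun x => min x r, ?_, fun a ha => min_eq_left ha.2.2, ?_, ?_⟩
    · rintro a ⟨ha, ha0, -⟩ b ⟨hb, hb0, -⟩
      rcases le_total (a + b) r with h | h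
      · simp only [min_eq_left h]
        exact ⟨S.add_mem ha hb, add_nonneg ha0 hb0, h⟩
      · simp only [min_eq_right h]
        exact ⟨hr, hr0, le_rfl⟩
    · intro u v d hd huv
      rcases le_total v r with h | h
      · simp only [min_eq_left h]
        exact (min_le_left _ _).trans huv
      · simp only [min_eq_right h]
        linarith [min_le_right u r]
    · rintro a ⟨-, -, har⟩ u v hu hv h
      simp only
      rcases le_total u r with h1 | h1 <;> rcases le_total v r with h2 | h2 <;>
        simp only [min_eq_left, min_eq_right, h1, h2] <;> linarith

/-- `d` is a `Δ`-valued pseudometric on `ℕ`. -/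
def IsPM (Δ : Set ℝ) (d : ℕ → ℕ → ℝ) : Prop :=
  (∀ i, d i i = 0) ∧ (∀ i j, d i j = d j i) ∧ (∀ i j k, d i k ≤ d i j + d j k) ∧
    ∀ i j, d i j ∈ Δ

/-- `T` is the graph of a one-point extension of a finite part of `(ℕ, d)`. -/
def Valid (Δ : Set ℝ) (d : ℕ → ℕ → ℝ) (T : Finset (ℕ × Δ)) : Prop :=
  T.Nonempty ∧ ∀ p ∈ T, ∀ q ∈ T,
    (p.2 : ℝ) ≤ q.2 + d q.1 p.1 ∧ d p.1 q.1 ≤ p.2 + (q.2 : ℝ)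

theorem exists_katetov {Δ : Set ℝ} (h : IsDistanceSet Δ) {d : ℕ → ℕ → ℝ} (hd : IsPM Δ d)
    {T : Finset (ℕ × Δ)} (hT : Valid Δ d T) :
    ∃ f : ℕ → ℝ, (∀ x, f x ∈ Δ) ∧ (∀ x y, f x ≤ f y + d x y) ∧ (∀ x y, d x y ≤ f x + f y) ∧
      ∀ p ∈ T, f p.1 = p.2 := by
  obtain ⟨-, -, hpos, c, c1, c2, c3, c4⟩ := exists_cap h
  obtain ⟨d0, ds, dt, dm⟩ := hd
  obtain ⟨hne, hv⟩ := hT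
  have key : ∀ x, ∃ p ∈ T, T.inf' hne (fun p => (p.2 : ℝ) + d p.1 x) = (p.2 : ℝ) + d p.1 x :=
    fun x => Finset.exists_mem_eq_inf' hne _
  have nn : ∀ x, 0 ≤ T.inf' hne (fun p => (p.2 : ℝ) + d p.1 x) := fun x =>
    Finset.le_inf' _ _ fun p _ => add_nonneg (hpos _ p.2.2) (hpos _ (dm _ _))
  refine ⟨fun x => c (T.inf' hne (fun p => (p.2 : ℝ) + d p.1 x)), ?_, ?_, ?_, ?_⟩
  · intro x
    obtain ⟨p, -, e⟩ := key x
    simp only [e]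
    exact c1 _ p.2.2 _ (dm _ _)
  · intro x y
    refine c3 _ _ _ (hpos _ (dm _ _)) ?_
    obtain ⟨p, hp, e⟩ := key y
    rw [e]
    refine (Finset.inf'_le _ hp).trans ?_
    linarith [dt p.1 y x, ds x y]
  · intro x y
    refine c4 _ (dm x y) _ _ (nn x) (nn y) ?_
    obtain ⟨p, hp, e⟩ := key x
    obtain ⟨q, hq, e'⟩ := key y
    rw [e, e']
    linarith [dt x p.1 y, dt p.1 q.1 y, ds x p.1, (hv p hp q hq).2]
  · intro p hp
    have : T.inf' hne (fun q => (q.2 : ℝ) + d q.1 p.1) = p.2 := by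
      refine le_antisymm ((Finset.inf'_le _ hp).trans (by simp [d0])) ?_
      exact Finset.le_inf' _ _ fun q hq => (hv p hp q hq).1
    simp only [this]
    exact c2 _ p.2.2

theorem exists_step {Δ : Set ℝ} (h : IsDistanceSet Δ) {d : ℕ → ℕ → ℝ} (hd : IsPM Δ d)
    (n : ℕ) (T : Finset (ℕ × Δ)) :
    ∃ d' : ℕ → ℕ → ℝ, IsPM Δ d' ∧ (∀ i j, i ≠ n → j ≠ n → d' i j = d i j) ∧
      (Valid Δ d T → (∀ p ∈ T, p.1 < n) → ∀ p ∈ T, d' n p.1 = p.2) := by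
  by_cases hT : Valid Δ d T
  · obtain ⟨f, f1, f2, f3, f4⟩ := exists_katetov h hd hT
    obtain ⟨-, h0, hpos, -⟩ := exists_cap h
    obtain ⟨d0, ds, dt, dm⟩ := hd
    refine ⟨fun i j => if i = n then (if j = n then 0 else f j) else if j = n then f i else d i j,
      ⟨?_, ?_, ?_, ?_⟩, ?_, ?_⟩
    · intro i
      by_cases hi : i = n <;> simp [hi, d0]
    · intro i j
      by_cases hi : i = n <;> by_cases hj : j = n <;> simp [hi, hj, ds]
    · intro i j k
      by_cases hi : i = n <;> by_cases hj : j = n <;> by_cases hk : k = n <;>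
        simp only [hi, hj, hk, if_true, if_false]
      · linarith
      · linarith
      · linarith [hpos _ (f1 j)]
      · linarith [f2 k j, ds k j]
      · linarith
      · exact f3 i k
      · linarith [f2 i j]
      · exact dt i j k
    · intro i j
      by_cases hi : i = n <;> by_cases hj : j = n <;> simp [hi, hj, h0, f1, dm]
    · intro i j hi hj
      simp [hi, hj]
    · intro _ hlt p hp
      have : p.1 ≠ n := (hlt p hp).ne
      simp [this, f4 p hp]
  · exact ⟨d, hd, fun _ _ _ _ => rfl, fun h' => absurd h' hT⟩

theorem exists_limit {Δ : Set ℝ} (h : IsDistanceSet Δ) :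
    ∃ D : ℕ → ℕ → ℝ, IsPM Δ D ∧ ∀ T : Finset (ℕ × Δ), Valid Δ D T →
      ∃ n, ∀ p ∈ T, D n p.1 = p.2 := by
  obtain ⟨hc, h0, -⟩ := exists_cap h
  have _ : Countable Δ := hc.to_subtype
  obtain ⟨g, hg⟩ := exists_surjective_nat (Finset (ℕ × Δ))
  let e : ℕ → Finset (ℕ × Δ) := fun n => g n.unpair.2
  have he : ∀ T N, ∃ n, N ≤ n ∧ e n = T := by
    intro T N
    obtain ⟨m, rfl⟩ := hg T
    exact ⟨Nat.pair N m, Nat.left_le_pair N m, by simp [e]⟩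
  have hz : IsPM Δ (fun _ _ => 0) :=
    ⟨fun _ => rfl, fun _ _ => rfl, fun _ _ _ => by simp, fun _ _ => h0⟩
  choose st st1 st2 st3 using
    fun (d : {d : ℕ → ℕ → ℝ // IsPM Δ d}) (n : ℕ) => exists_step h d.2 n (e n)
  let s : ℕ → {d : ℕ → ℕ → ℝ // IsPM Δ d} := fun n =>
    Nat.rec ⟨_, hz⟩ (fun n d => ⟨st d n, st1 d n⟩) n
  have hs : ∀ n, (s (n + 1)).1 = st (s n) n := fun n => rfl
  have stab : ∀ i j N, max i j + 1 ≤ N → (s N).1 i j = (s (max i j + 1)).1 i j := by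
    intro i j N hN
    induction N, hN using Nat.le_induction with
    | base => rfl
    | succ N hN ih =>
      have h1 : i ≤ max i j := le_max_left _ _
      have h2 : j ≤ max i j := le_max_right _ _
      rw [hs, st2 _ _ i j (by omega) (by omega), ih]
  let D : ℕ → ℕ → ℝ := fun i j => (s (max i j + 1)).1 i j
  have hD : ∀ i j N, i < N → j < N → D i j = (s N).1 i j := by
    intro i j N hi hj
    refine (stab i j N ?_).symm
    have := max_lt hi hj
    omega
  refine ⟨D, ⟨fun i => (s (max i i + 1)).2.1 i, ?_, ?_, fun i j => (s (max i j + 1)).2.2.2.2 i j⟩, ?_⟩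
  · intro i j
    rw [hD i j (i + j + 1) (by omega) (by omega), hD j i (i + j + 1) (by omega) (by omega)]
    exact (s (i + j + 1)).2.2.1 i j
  · intro i j k
    rw [hD i k (i + j + k + 1) (by omega) (by omega), hD i j (i + j + k + 1) (by omega) (by omega),
      hD j k (i + j + k + 1) (by omega) (by omega)]
    exact (s (i + j + k + 1)).2.2.2.1 i j k
  · intro T hT
    obtain ⟨n, hn, hnT⟩ := he T (T.sup Prod.fst + 1)
    have hlt : ∀ p ∈ T, p.1 < n := fun p hp => by
      have : p.1 ≤ T.sup Prod.fst := Finset.le_sup (f := Prod.fst) hp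
      omega
    refine ⟨n, fun p hp => ?_⟩
    rw [hD n p.1 (n + 1) (by omega) (by have := hlt p hp; omega), hs]
    refine st3 (s n) n ?_ ?_ p (by rwa [hnT])
    · rw [hnT]
      refine ⟨hT.1, fun p hp q hq => ?_⟩
      rw [← hD _ _ n (hlt q hq) (hlt p hp), ← hD _ _ n (hlt p hp) (hlt q hq)]
      exact hT.2 p hp q hq
    · rw [hnT]
      exact hlt

/-- The one-point extension property. -/
def HasExtension (Δ : Set ℝ) (X : Type*) [MetricSpace X] : Prop :=
  Nonempty X ∧ ∀ (A : Finset X) (f : X → ℝ), (∀ x ∈ A, f x ∈ Δ) →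
    (∀ x ∈ A, ∀ y ∈ A, f x ≤ f y + dist x y ∧ dist x y ≤ f x + f y) →
    ∃ z : X, ∀ x ∈ A, dist z x = f x

theorem hasExtension_quotient {Δ : Set ℝ} {ι : Type} [PseudoMetricSpace ι] [Nonempty ι]
    (hE : ∀ T : Finset (ι × Δ), T.Nonempty → (∀ p ∈ T, ∀ q ∈ T,
      (p.2 : ℝ) ≤ q.2 + dist q.1 p.1 ∧ dist p.1 q.1 ≤ p.2 + (q.2 : ℝ)) →
      ∃ n : ι, ∀ p ∈ T, dist n p.1 = p.2) :
    HasExtension Δ (SeparationQuotient ι) := by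
  classical
  have hdist : ∀ i j : ι, dist (SeparationQuotient.mk i) (SeparationQuotient.mk j) = dist i j :=
    fun i j => SeparationQuotient.dist_mk i j
  have hsurj := SeparationQuotient.surjective_mk (X := ι)
  refine ⟨inferInstance, ?_⟩
  intro A f hf hA
  rcases A.eq_empty_or_nonempty with rfl | hne
  · exact ⟨SeparationQuotient.mk (Classical.arbitrary ι), by simp⟩
  choose r hr using hsurj
  let T : Finset (ι × Δ) := A.attach.image fun a => (r a.1, ⟨f a.1, hf a.1 a.2⟩)
  obtain ⟨n, hn⟩ := hE T (by simpa [T] using hne) (by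
    intro p hp q hq
    simp only [T, Finset.mem_image, Finset.mem_attach, true_and] at hp hq
    obtain ⟨a, rfl⟩ := hp
    obtain ⟨b, rfl⟩ := hq
    simp only [← hdist, hr]
    exact ⟨by rw [dist_comm]; exact (hA a.1 a.2 b.1 b.2).1, (hA a.1 a.2 b.1 b.2).2⟩)
  refine ⟨SeparationQuotient.mk n, fun x hx => ?_⟩
  have h1 := hn (r x, ⟨f x, hf x hx⟩)
    (Finset.mem_image.2 ⟨⟨x, hx⟩, Finset.mem_attach _ _, rfl⟩)
  rw [← hdist, hr x] at h1
  exact h1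

theorem isDeltaMetric_quotient {Δ : Set ℝ} {ι : Type} [PseudoMetricSpace ι]
    (h : ∀ i j : ι, dist i j ∈ Δ) : IsDeltaMetric Δ (SeparationQuotient ι) := by
  intro x y
  obtain ⟨i, rfl⟩ := SeparationQuotient.surjective_mk x
  obtain ⟨j, rfl⟩ := SeparationQuotient.surjective_mk y
  rw [SeparationQuotient.dist_mk]
  exact h i j

theorem exists_hasExtension {Δ : Set ℝ} (h : IsDistanceSet Δ) :
    ∃ (X : Type) (_ : MetricSpace X), Countable X ∧ IsDeltaMetric Δ X ∧ HasExtension Δ X := by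
  obtain ⟨D, ⟨D0, Ds, Dt, Dm⟩, hE⟩ := exists_limit h
  let m : PseudoMetricSpace ℕ :=
    { dist := D, dist_self := D0, dist_comm := Ds, dist_triangle := Dt }
  exact ⟨@SeparationQuotient ℕ m.toUniformSpace.toTopologicalSpace,
    @SeparationQuotient.instMetricSpace ℕ m,
    (@SeparationQuotient.surjective_mk ℕ m.toUniformSpace.toTopologicalSpace).countable,
    @isDeltaMetric_quotient Δ ℕ m Dm,
    @hasExtension_quotient Δ ℕ m _ fun T h1 h2 => hE T ⟨h1, h2⟩⟩

/-- Finite partial isometries from `Y` to `X`, as graphs. -/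
abbrev PartialIsom (Y X : Type*) [MetricSpace Y] [MetricSpace X] : Type _ :=
  {P : Finset (Y × X) // ∀ p ∈ P, ∀ q ∈ P, dist p.1 q.1 = dist p.2 q.2}

theorem extend_left {Δ : Set ℝ} {Y X : Type*} [MetricSpace Y] [MetricSpace X]
    (hY : IsDeltaMetric Δ Y) (hX : HasExtension Δ X) (P : PartialIsom Y X) (y : Y) :
    ∃ Q : PartialIsom Y X, (∃ x, (y, x) ∈ Q.1) ∧ P ≤ Q := by
  classical
  have hfun : ∀ p ∈ P.1, ∃ t : ℝ, t = dist y p.1 ∧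
      ∀ q ∈ P.1, q.2 = p.2 → t = dist y q.1 := fun p hp =>
    ⟨_, rfl, fun q hq e => by
      have : dist p.1 q.1 = 0 := by rw [P.2 p hp q hq, e, dist_self]
      rw [dist_eq_zero.1 this]⟩
  let f : X → ℝ := fun x => if hx : ∃ p ∈ P.1, p.2 = x then dist y hx.choose.1 else 0
  have hf : ∀ p ∈ P.1, f p.2 = dist y p.1 := by
    intro p hp
    have hx : ∃ q ∈ P.1, q.2 = p.2 := ⟨p, hp, rfl⟩
    obtain ⟨t, ht, h⟩ := hfun p hp
    simp only [f, dif_pos hx]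
    rw [← ht, h _ hx.choose_spec.1 hx.choose_spec.2]
  obtain ⟨z, hz⟩ := hX.2 (P.1.image Prod.snd) f (by
      intro x hx
      obtain ⟨p, hp, rfl⟩ := Finset.mem_image.1 hx
      rw [hf p hp]
      exact hY _ _) (by
      intro x hx x' hx'
      obtain ⟨p, hp, rfl⟩ := Finset.mem_image.1 hx
      obtain ⟨q, hq, rfl⟩ := Finset.mem_image.1 hx'
      rw [hf p hp, hf q hq, ← P.2 p hp q hq]
      exact ⟨by rw [dist_comm p.1 q.1]; exact dist_triangle _ _ _, dist_triangle_left _ _ _⟩)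
  have hz' : ∀ p ∈ P.1, dist y p.1 = dist z p.2 := fun p hp => by
    rw [hz _ (Finset.mem_image_of_mem _ hp), hf p hp]
  refine ⟨⟨insert (y, z) P.1, ?_⟩, ⟨z, Finset.mem_insert_self _ _⟩, Finset.subset_insert _ _⟩
  intro p hp q hq
  rcases Finset.mem_insert.1 hp with rfl | hp <;> rcases Finset.mem_insert.1 hq with rfl | hq
  · simp
  · exact hz' q hq
  · rw [dist_comm, dist_comm p.2]
    exact hz' p hp
  · exact P.2 p hp q hq

theorem extend_right {Δ : Set ℝ} {Y X : Type*} [MetricSpace Y] [MetricSpace X]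
    (hX : IsDeltaMetric Δ X) (hY : HasExtension Δ Y) (P : PartialIsom Y X) (x : X) :
    ∃ Q : PartialIsom Y X, (∃ y, (y, x) ∈ Q.1) ∧ P ≤ Q := by
  classical
  obtain ⟨Q, ⟨y, hy⟩, hPQ⟩ := extend_left hX hY ⟨P.1.image Prod.swap, by
    intro p hp q hq
    obtain ⟨p', hp', rfl⟩ := Finset.mem_image.1 hp
    obtain ⟨q', hq', rfl⟩ := Finset.mem_image.1 hq
    exact (P.2 p' hp' q' hq').symm⟩ x
  refine ⟨⟨Q.1.image Prod.swap, ?_⟩, ⟨y, Finset.mem_image.2 ⟨_, hy, rfl⟩⟩, ?_⟩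
  · intro p hp q hq
    obtain ⟨p', hp', rfl⟩ := Finset.mem_image.1 hp
    obtain ⟨q', hq', rfl⟩ := Finset.mem_image.1 hq
    exact (Q.2 p' hp' q' hq').symm
  · intro p hp
    exact Finset.mem_image.2 ⟨p.swap, hPQ (Finset.mem_image_of_mem _ hp), Prod.swap_swap p⟩

theorem exists_isometry {Δ : Set ℝ} {Y X : Type*} [MetricSpace Y] [MetricSpace X] [Countable Y]
    (hY : IsDeltaMetric Δ Y) (hX : HasExtension Δ X) : ∃ f : Y → X, Isometry f := by
  cases nonempty_encodable Y
  let 𝒟 : Y → Order.Cofinal (PartialIsom Y X) := fun y =>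
    ⟨{P | ∃ x, (y, x) ∈ P.1}, fun P => extend_left hY hX P y⟩
  let I := Order.idealOfCofinals (⟨∅, by simp⟩ : PartialIsom Y X) 𝒟
  have h : ∀ y, ∃ x, ∃ P ∈ I, (y, x) ∈ P.1 := fun y => by
    obtain ⟨P, ⟨x, hx⟩, hP⟩ := Order.cofinal_meets_idealOfCofinals _ 𝒟 y
    exact ⟨x, P, hP, hx⟩
  choose f P hP hf using h
  refine ⟨f, Isometry.of_dist_eq fun y y' => ?_⟩
  obtain ⟨Q, -, h1, h2⟩ := I.directed _ (hP y) _ (hP y')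
  exact (Q.2 _ (h1 (hf y)) _ (h2 (hf y'))).symm

theorem exists_isometryEquiv {Δ : Set ℝ} {X : Type*} [MetricSpace X] [Countable X]
    (hX : IsDeltaMetric Δ X) (hE : HasExtension Δ X) (P₀ : PartialIsom X X) :
    ∃ g : X ≃ᵢ X, ∀ p ∈ P₀.1, g p.1 = p.2 := by
  cases nonempty_encodable X
  let 𝒟 : X ⊕ X → Order.Cofinal (PartialIsom X X) := Sum.elim
    (fun y => ⟨{P | ∃ x, (y, x) ∈ P.1}, fun P => extend_left hX hE P y⟩)
    (fun x => ⟨{P | ∃ y, (y, x) ∈ P.1}, fun P => extend_right hX hE P x⟩)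
  let I := Order.idealOfCofinals P₀ 𝒟
  have h : ∀ y, ∃ x, ∃ P ∈ I, (y, x) ∈ P.1 := fun y => by
    obtain ⟨P, ⟨x, hx⟩, hP⟩ := Order.cofinal_meets_idealOfCofinals P₀ 𝒟 (Sum.inl y)
    exact ⟨x, P, hP, hx⟩
  have h' : ∀ x, ∃ y, ∃ P ∈ I, (y, x) ∈ P.1 := fun x => by
    obtain ⟨P, ⟨y, hy⟩, hP⟩ := Order.cofinal_meets_idealOfCofinals P₀ 𝒟 (Sum.inr x)
    exact ⟨y, P, hP, hy⟩
  have compat : ∀ p q : X × X, (∃ P ∈ I, p ∈ P.1) → (∃ P ∈ I, q ∈ P.1) →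
      dist p.1 q.1 = dist p.2 q.2 := by
    rintro p q ⟨P, hP, hp⟩ ⟨Q, hQ, hq⟩
    obtain ⟨R, -, h1, h2⟩ := I.directed _ hP _ hQ
    exact R.2 _ (h1 hp) _ (h2 hq)
  choose f hf using h
  choose k hk using h'
  have hfk : ∀ x, f (k x) = x := fun x => by
    have := compat (k x, f (k x)) (k x, x) (hf _) (hk _)
    simpa using this.symm
  refine ⟨IsometryEquiv.mk' f k hfk (Isometry.of_dist_eq fun y y' =>
    (compat (y, f y) (y', f y') (hf y) (hf y')).symm), fun p hp => ?_⟩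
  have h1 := compat (p.1, f p.1) p (hf _) ⟨P₀, Order.mem_idealOfCofinals P₀ 𝒟, hp⟩
  have h2 : f p.1 = p.2 := by simpa using h1.symm
  exact h2

end UrysohnExistence

open UrysohnExistence in
/-- Every distance set has a Urysohn space. -/
theorem IsDistanceSet.exists_isUrysohnSpace {Δ : Set ℝ} (h : IsDistanceSet Δ) :
    ∃ (X : Type) (_ : MetricSpace X), IsUrysohnSpace Δ X := by
  classical
  obtain ⟨X, mX, hc, hX, hE⟩ := exists_hasExtension h
  refine ⟨X, mX, hc, hX, ?_, fun Y _ _ hY => exists_isometry hY hE⟩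
  intro A B hA _ φ
  let _ : Fintype A := hA.fintype
  obtain ⟨g, hg⟩ := exists_isometryEquiv hX hE
    ⟨Finset.univ.image fun a : A => ((a : X), (φ a : X)), by
      intro p hp q hq
      simp only [Finset.mem_image, Finset.mem_univ, true_and] at hp hq
      obtain ⟨a, rfl⟩ := hp
      obtain ⟨b, rfl⟩ := hq
      exact (φ.isometry.dist_eq a b).symm⟩
  exact ⟨g, fun a => hg ((a : X), (φ a : X)) (by simp)⟩

/-! ## Distance sets -/

/-! Universality and ultrahomogeneity together realise every finite `Δ`-valued amalgam over a given
finite part of `X`. Write `V_A` for the pointwise stabiliser of a finite set `A`; these subgroups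
form a neighbourhood basis at the identity. The double coset `V_A g V_A` is determined by the matrix
of distances `dist a (g b)` (`exists_mul_mul_eq`). Hence `E` is Roelcke precompact exactly when each
set `{dist x (e y) | e ∈ E}` is finite, and the last two equivalences become questions of which
distances occur.

For coarse boundedness, `A` can be moved to constant distance `r` from any finite set `B`, provided
that `A` and `B` have diameter at most `2r`. Isometries putting `A` at constant distance `r` from
itself form a single double coset `V_A f V_A`. If `r` is large enough for `A ∪ g A`, then `g` is a
product of two of them, so that an écart that is small on `V_A` bounds all such `g` uniformly. One
`r` serves the whole stabiliser of a point, and the whole group if `Δ` has a greatest element.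
Conversely, the displacement of a point is a continuous left-invariant écart taking every value in
`Δ`. -/

theorem IsDistanceSet.nonneg {Δ : Set ℝ} (h : IsDistanceSet Δ) {t : ℝ} (ht : t ∈ Δ) : 0 ≤ t :=
  (UrysohnExistence.exists_cap h).2.2.1 t ht

theorem IsDistanceSet.zero_mem {Δ : Set ℝ} (h : IsDistanceSet Δ) : (0 : ℝ) ∈ Δ :=
  (UrysohnExistence.exists_cap h).2.1

/-- A bounded distance set has a greatest element. -/
theorem IsDistanceSet.exists_isGreatest {Δ : Set ℝ} (h : IsDistanceSet Δ) (hb : BddAbove Δ) :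
    ∃ m, IsGreatest Δ m := by
  obtain ⟨S, -, hp, rfl | ⟨r, hr, rfl⟩⟩ := h
  -- A bounded semigroup is trivial: the multiples of a positive element are unbounded.
  · refine ⟨0, S.zero_mem, fun s hs => ?_⟩
    obtain ⟨R, hR⟩ := hb
    by_contra! h0
    obtain ⟨n, hn⟩ := Archimedean.arch (R + 1) h0
    have := hR (S.nsmul_mem hs n)
    linarith
  · exact ⟨r, ⟨hr, hp r hr, le_rfl⟩, fun s hs => hs.2.2⟩

/-- Supplies a constant for amalgams. It need not exceed `R`, which is impossible when `Δ` is
bounded below `R`; the greatest element then serves. -/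
theorem IsDistanceSet.exists_forall_le {Δ : Set ℝ} (h : IsDistanceSet Δ) (R : ℝ) :
    ∃ s ∈ Δ, ∀ t ∈ Δ, t ≤ R → t ≤ s := by
  by_cases hb : BddAbove Δ
  · obtain ⟨m, hm, hle⟩ := h.exists_isGreatest hb
    exact ⟨m, hm, fun t ht _ => hle ht⟩
  · rw [not_bddAbove_iff] at hb
    obtain ⟨s, hs, hR⟩ := hb R
    exact ⟨s, hs, fun t _ h => h.trans hR.le⟩

theorem IsDistanceSet.isBounded_iff {Δ : Set ℝ} (h : IsDistanceSet Δ) :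
    Bornology.IsBounded Δ ↔ BddAbove Δ := by
  rw [isBounded_iff_bddBelow_bddAbove]
  exact and_iff_right ⟨0, fun _ => h.nonneg⟩

theorem IsDistanceSet.isClosed_and_isDiscrete_iff {Δ : Set ℝ} (h : IsDistanceSet Δ) :
    IsClosed Δ ∧ IsDiscrete Δ ↔ ∀ R, (Δ ∩ Set.Iic R).Finite := by
  constructor
  · rintro ⟨hc, hd⟩ R
    have : Δ ∩ Set.Iic R = Δ ∩ Set.Icc 0 R := by
      ext t
      exact ⟨fun ht => ⟨ht.1, h.nonneg ht.1, ht.2⟩, fun ht => ⟨ht.1, ht.2.2⟩⟩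
    rw [this]
    exact (isCompact_Icc.inter_left hc).finite (hd.mono Set.inter_subset_left)
  · intro hf
    rw [isClosed_and_discrete_iff]
    intro x
    rw [disjoint_principal_right]
    have h1 : ((Δ ∩ Set.Iic (x + 1)) \ {x})ᶜ ∈ 𝓝 x :=
      ((hf (x + 1)).sdiff).isClosed.isOpen_compl.mem_nhds (by simp)
    filter_upwards [mem_nhdsWithin_of_mem_nhds h1,
      mem_nhdsWithin_of_mem_nhds (Iic_mem_nhds (lt_add_one x)), self_mem_nhdsWithin] with y h1 h2 h3 hy
    exact h1 ⟨⟨hy, h2⟩, h3⟩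

/-! ## Amalgamation and homogeneity -/

namespace IsUrysohnSpace

variable {Δ : Set ℝ} {X : Type*} [MetricSpace X]

theorem exists_isometryEquiv (hX : IsUrysohnSpace Δ X) {ι : Type*} [Finite ι] (i j : ι → X)
    (h : ∀ k l, dist (i k) (i l) = dist (j k) (j l)) : ∃ g : X ≃ᵢ X, ∀ k, g (i k) = j k := by
  -- The family `i` may repeat points; equality of distances makes `i k ↦ j k` well defined.
  have hc : ∀ k (hk : i k ∈ Set.range i), j hk.choose = j k := fun k hk => by
    rw [← dist_eq_zero, ← h, hk.choose_spec, dist_self]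
  let f : Set.range i → X := fun a => j a.2.choose
  have hf : Isometry f := Isometry.of_dist_eq fun a b => by
    rw [← h, a.2.choose_spec, b.2.choose_spec, Subtype.dist_eq]
  obtain ⟨g, hg⟩ := hX.ultrahomogeneous (Set.range i) (Set.range f) (Set.finite_range i)
    (Set.finite_range f) hf.isometryEquivOnRange
  exact ⟨g, fun k => (hg ⟨i k, k, rfl⟩).trans (hc k ⟨k, rfl⟩)⟩

/-- Every countable `Δ`-valued pseudometric is realised in `𝕌_Δ`, with prescribed values on a
finite part. -/
theorem exists_realization (hX : IsUrysohnSpace Δ X) {Y ι : Type*} [Countable Y] [Finite ι]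
    (d : Y → Y → ℝ) (d0 : ∀ x, d x x = 0) (ds : ∀ x y, d x y = d y x)
    (dt : ∀ x y z, d x z ≤ d x y + d y z) (dm : ∀ x y, d x y ∈ Δ)
    (i : ι → Y) (j : ι → X) (h : ∀ k l, dist (j k) (j l) = d (i k) (i l)) :
    ∃ f : Y → X, (∀ x y, dist (f x) (f y) = d x y) ∧ ∀ k, f (i k) = j k := by
  -- Universality speaks of metric spaces in `Type`, so `Y` is shrunk and points at distance zero
  -- are identified.
  have hY : Small.{0} Y := Countable.toSmall Y
  let e : Y ≃ Shrink.{0} Y := equivShrink.{0} Y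
  let m : PseudoMetricSpace (Shrink.{0} Y) :=
    { dist := fun x y => d (e.symm x) (e.symm y)
      dist_self := fun _ => d0 _
      dist_comm := fun _ _ => ds _ _
      dist_triangle := fun _ _ _ => dt _ _ _ }
  have hc : Countable (Shrink.{0} Y) := e.symm.injective.countable
  have hq : Countable (SeparationQuotient (Shrink.{0} Y)) :=
    SeparationQuotient.surjective_mk.countable
  obtain ⟨φ, hφ⟩ := hX.universal (SeparationQuotient (Shrink.{0} Y))
    (UrysohnExistence.isDeltaMetric_quotient fun _ _ => dm _ _)
  have hd : ∀ x y : Y, dist (φ (SeparationQuotient.mk (e x))) (φ (SeparationQuotient.mk (e y))) =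
      d x y := fun x y => by
    rw [hφ.dist_eq, SeparationQuotient.dist_mk]
    change d (e.symm (e x)) (e.symm (e y)) = _
    simp
  -- Homogeneity corrects the embedding on the prescribed finite part.
  obtain ⟨g, hg⟩ := hX.exists_isometryEquiv (fun k => φ (SeparationQuotient.mk (e (i k)))) j
    fun k l => by rw [hd, h]
  exact ⟨fun y => g (φ (SeparationQuotient.mk (e y))), fun x y => by rw [g.isometry.dist_eq, hd], hg⟩

protected theorem nonempty (hX : IsUrysohnSpace Δ X) (h : IsDistanceSet Δ) : Nonempty X := by
  obtain ⟨f, -⟩ := hX.universal PUnit fun _ _ => by simpa using h.zero_mem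
  exact ⟨f ⟨⟩⟩

theorem exists_dist_apply_eq (hX : IsUrysohnSpace Δ X) (h : IsDistanceSet Δ) (x : X) {t : ℝ}
    (ht : t ∈ Δ) : ∃ g : X ≃ᵢ X, dist x (g x) = t := by
  have h0 := h.nonneg ht
  have h1 := h.zero_mem
  obtain ⟨f, hf, hx⟩ := hX.exists_realization (fun a b : Bool => if a = b then 0 else t)
    (by simp) (by simp [eq_comm]) (by
      intro a b c
      cases a <;> cases b <;> cases c <;> simp [h0]) (by
      intro a b
      cases a <;> cases b <;> simp [h1, ht]) (fun _ : Unit => false) (fun _ => x) (by simp)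
  obtain ⟨g, hg⟩ := hX.exists_isometryEquiv (fun _ : Unit => x) (fun _ => f true) (by simp)
  refine ⟨g, ?_⟩
  rw [hg (), ← hx (), hf]
  simp

/-- A finite set can be moved to constant distance `r` from another one, if both have diameter at
most `2r`. -/
theorem exists_dist_apply_eq_const (hX : IsUrysohnSpace Δ X) (h : IsDistanceSet Δ)
    {A B : Set X} (hA : A.Finite) (hB : B.Finite) {r : ℝ} (hr : r ∈ Δ)
    (hAr : ∀ a ∈ A, ∀ b ∈ A, dist a b ≤ 2 * r) (hBr : ∀ a ∈ B, ∀ b ∈ B, dist a b ≤ 2 * r) :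
    ∃ g : X ≃ᵢ X, ∀ a ∈ A, ∀ b ∈ B, dist (g a) b = r := by
  have := hA.to_subtype
  have := hB.to_subtype
  have hr0 := h.nonneg hr
  -- The amalgam is the disjoint union of `A` and `B` with all cross distances `r`. The diameter
  -- bounds are the triangle inequality for two points of one side and a point of the other.
  obtain ⟨f, hf, hfB⟩ := hX.exists_realization
    (fun y z : A ⊕ B => Sum.elim (fun a : A => Sum.elim (fun a' : A => dist (a : X) a') (fun _ => r) z)
      (fun b : B => Sum.elim (fun _ => r) (fun b' : B => dist (b : X) b') z) y)
    (by rintro (a | a) <;> simp)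
    (by rintro (a | a) (b | b) <;> simp [dist_comm])
    (by
      rintro (a | a) (b | b) (c | c) <;>
        simp only [Sum.elim_inl, Sum.elim_inr, le_add_iff_nonneg_left, le_add_iff_nonneg_right,
          dist_nonneg]
      · exact dist_triangle _ _ _
      · linarith [hAr a a.2 c c.2]
      · linarith [hBr a a.2 c c.2]
      · exact dist_triangle _ _ _)
    (by rintro (a | a) (b | b) <;> simp [hr, hX.isDeltaMetric _ _])
    (Sum.inr : B → A ⊕ B) (fun b => (b : X)) (by simp)
  obtain ⟨g, hg⟩ := hX.exists_isometryEquiv (fun a : A => (a : X)) (fun a => f (Sum.inl a))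
    (by simp [hf])
  refine ⟨g, fun a ha b hb => ?_⟩
  rw [hg ⟨a, ha⟩, show b = f (Sum.inr ⟨b, hb⟩) from (hfB ⟨b, hb⟩).symm, hf]
  simp

/-- A point at constant distance `s` from a finite set can be moved by any `t ≤ 2s` while fixing
the set. -/
theorem exists_fixing_dist_apply_eq (hX : IsUrysohnSpace Δ X) (h : IsDistanceSet Δ)
    {A : Set X} (hA : A.Finite) {s t : ℝ} (hs : s ∈ Δ) (ht : t ∈ Δ) (hts : t ≤ 2 * s)
    {y : X} (hAs : ∀ a ∈ A, ∀ b ∈ A, dist a b ≤ 2 * s) (hy : ∀ a ∈ A, dist y a = s) :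
    ∃ g : X ≃ᵢ X, (∀ a ∈ A, g a = a) ∧ dist y (g y) = t := by
  have := hA.to_subtype
  have hs0 := h.nonneg hs
  have ht0 := h.nonneg ht
  -- Here `false` stands for `y` and `true` for its future image: both lie at distance `s` from `A`,
  -- and `t` apart.
  obtain ⟨f, hf, hfA⟩ := hX.exists_realization
    (fun y z : A ⊕ Bool => Sum.elim
      (fun a : A => Sum.elim (fun a' : A => dist (a : X) a') (fun _ => s) z)
      (fun b : Bool => Sum.elim (fun _ => s) (fun b' : Bool => if b = b' then 0 else t) z) y)
    (by rintro (a | a) <;> simp)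
    (by rintro (a | a) (b | b) <;> simp [dist_comm, eq_comm])
    (by
      rintro (a | a) (b | b) (c | c) <;>
        simp only [Sum.elim_inl, Sum.elim_inr, le_add_iff_nonneg_left, le_add_iff_nonneg_right,
          dist_nonneg]
      · exact dist_triangle _ _ _
      · linarith [hAs a a.2 c c.2]
      · split_ifs <;> linarith
      · split_ifs <;> linarith
      · split_ifs <;> linarith
      · cases a <;> cases b <;> cases c <;> simp [ht0])
    (by
      rintro (a | a) (b | b)
      · exact hX.isDeltaMetric _ _
      · exact hs
      · exact hs
      · simp only [Sum.elim_inr]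
        split_ifs
        exacts [h.zero_mem, ht])
    (Sum.map id (fun _ => false) : A ⊕ Unit → A ⊕ Bool) (Sum.elim (fun a => (a : X)) (fun _ => y))
    (by rintro (a | a) (b | b) <;> simp [hy, dist_comm])
  obtain ⟨g, hg⟩ := hX.exists_isometryEquiv
    (fun z : A ⊕ Unit => f (Sum.map id (fun _ => false) z))
    (fun z => f (Sum.map id (fun _ => true) z))
    (by rintro (a | a) (b | b) <;> simp [hf])
  have hA' : ∀ a : A, f (Sum.inl a) = a := fun a => hfA (Sum.inl a)
  have hy' : f (Sum.inr false) = y := hfA (Sum.inr ())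
  refine ⟨g, fun a ha => ?_, ?_⟩
  · have := hg (Sum.inl ⟨a, ha⟩)
    simpa [hA'] using this
  · have := hg (Sum.inr ())
    simp only [Sum.map_inr] at this
    rw [← hy', this, hf]
    simp

/-- The double cosets of the pointwise stabiliser of a finite set are determined by distances. -/
theorem exists_mul_mul_eq (hX : IsUrysohnSpace Δ X) {A : Set X} (hA : A.Finite) {g k : X ≃ᵢ X}
    (h : ∀ a ∈ A, ∀ b ∈ A, dist a (g b) = dist a (k b)) :
    ∃ u v : X ≃ᵢ X, (∀ a ∈ A, u a = a) ∧ (∀ a ∈ A, v a = a) ∧ u * g * v = k := by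
  have := hA.to_subtype
  obtain ⟨u, hu⟩ := hX.exists_isometryEquiv
    (Sum.elim (fun a => (a : X)) (fun a => g a) : A ⊕ A → X)
    (Sum.elim (fun a => (a : X)) (fun a => k a))
    (by
      rintro (a | a) (b | b) <;> simp only [Sum.elim_inl, Sum.elim_inr, IsometryEquiv.dist_eq]
      · exact h a a.2 b b.2
      · rw [dist_comm, h b b.2 a a.2, dist_comm])
  refine ⟨u, g⁻¹ * u⁻¹ * k, fun a ha => hu (Sum.inl ⟨a, ha⟩), fun a ha => ?_, by group⟩
  have : u (g a) = k a := hu (Sum.inr ⟨a, ha⟩)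
  rw [IsometryEquiv.mul_apply, IsometryEquiv.mul_apply, ← this, IsometryEquiv.inv_apply_self,
    IsometryEquiv.inv_apply_self]

end IsUrysohnSpace

/-! ## The permutation topology -/

namespace IsometryEquiv

variable {X : Type*} [MetricSpace X]

theorem exists_finite_of_isOpen {E : Set (X ≃ᵢ X)} (hE : IsOpen E) {g : X ≃ᵢ X} (hg : g ∈ E) :
    ∃ A : Set X, A.Finite ∧ ∀ k : X ≃ᵢ X, (∀ a ∈ A, k a = g a) → k ∈ E := by
  let _ : TopologicalSpace X := ⊥
  obtain ⟨s, hs, rfl⟩ := isOpen_induced_iff.1 hE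
  obtain ⟨I, u, hu, hI⟩ := isOpen_pi_iff.1 hs _ hg
  refine ⟨I, I.finite_toSet, fun k hk => hI fun a ha => ?_⟩
  simp only [hk a ha]
  exact (hu a ha).2

theorem exists_finite_of_mem_nhds_one {U : Set (X ≃ᵢ X)} (hU : U ∈ 𝓝 1) :
    ∃ A : Set X, A.Finite ∧ {k : X ≃ᵢ X | ∀ a ∈ A, k a = a} ⊆ U := by
  obtain ⟨V, hVU, hV, h1⟩ := mem_nhds_iff.1 hU
  obtain ⟨A, hA, h⟩ := exists_finite_of_isOpen hV h1
  exact ⟨A, hA, fun k hk => hVU (h k hk)⟩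

theorem isOpen_fixing (x : X) : IsOpen {g : X ≃ᵢ X | g x = x} := isOpen_apply_eq x x

theorem fixing_mem_nhds_one (x : X) : {g : X ≃ᵢ X | g x = x} ∈ 𝓝 1 :=
  (isOpen_fixing x).mem_nhds rfl

/-- The écart of displacement of a point. -/
def orbitPseudoMetric (x : X) : PseudoMetric (X ≃ᵢ X) ℝ where
  toFun g k := dist (g x) (k x)
  refl' _ := dist_self _
  symm' _ _ := dist_comm _ _
  triangle' _ _ _ := dist_triangle _ _ _

theorem continuous_orbitPseudoMetric (x : X) :
    Continuous fun p : (X ≃ᵢ X) × (X ≃ᵢ X) => orbitPseudoMetric x p.1 p.2 := by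
  refine ⟨fun s _ => ?_⟩
  have : (fun p : (X ≃ᵢ X) × (X ≃ᵢ X) => orbitPseudoMetric x p.1 p.2) ⁻¹' s =
      ⋃ (y : X) (z : X) (_ : dist y z ∈ s), {g : X ≃ᵢ X | g x = y} ×ˢ {g : X ≃ᵢ X | g x = z} := by
    ext p
    simp [orbitPseudoMetric, PseudoMetric.mk_apply]
  rw [this]
  exact isOpen_iUnion fun y => isOpen_iUnion fun z => isOpen_iUnion fun _ =>
    (isOpen_apply_eq x y).prod (isOpen_apply_eq x z)

/-- If `u` fixes `x` and `v` fixes `y`, then `dist x (u (f (v y))) = dist x (f y)`, so the finite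
set `F` already yields all values. -/
theorem finite_dist_apply_of_isRoelckePrecompactSet {E : Set (X ≃ᵢ X)}
    (hE : IsRoelckePrecompactSet E) (x y : X) : ((fun e : X ≃ᵢ X => dist x (e y)) '' E).Finite := by
  obtain ⟨F, hF, hEF⟩ := hE _ (inter_mem (fixing_mem_nhds_one x) (fixing_mem_nhds_one y))
  refine (hF.image fun e : X ≃ᵢ X => dist x (e y)).subset ?_
  rintro _ ⟨e, he, rfl⟩
  obtain ⟨_, ⟨u, ⟨hu, -⟩, f, hf, rfl⟩, v, ⟨-, hv⟩, rfl⟩ := hEF he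
  refine ⟨f, hf, ?_⟩
  simp only [Set.mem_ofPred_eq] at hu hv
  simp only [mul_apply, hv]
  nth_rewrite 2 [← hu]
  rw [u.dist_eq]

end IsometryEquiv

/-! ## Coarse boundedness and Roelcke precompactness in the isometry group -/

namespace IsUrysohnSpace

variable {Δ : Set ℝ} {X : Type*} [MetricSpace X]

theorem isRoelckePrecompactSet_iff (hX : IsUrysohnSpace Δ X) {E : Set (X ≃ᵢ X)} :
    IsRoelckePrecompactSet E ↔
      ∀ x y : X, ((fun e : X ≃ᵢ X => dist x (e y)) '' E).Finite := by
  refine ⟨fun h => IsometryEquiv.finite_dist_apply_of_isRoelckePrecompactSet h, fun h U hU => ?_⟩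
  obtain ⟨A, hA, hAU⟩ := IsometryEquiv.exists_finite_of_mem_nhds_one hU
  have := hA.to_subtype
  let m : (X ≃ᵢ X) → A × A → ℝ := fun e p => dist (p.1 : X) (e p.2)
  have hm : (m '' E).Finite := by
    refine (Set.Finite.pi' fun p : A × A => h p.1 p.2).subset ?_
    rintro _ ⟨e, he, rfl⟩ p
    exact ⟨e, he, rfl⟩
  -- One representative in `E` for each of the finitely many distance matrices.
  refine ⟨Function.invFunOn m E '' (m '' E), hm.image _, fun e he => ?_⟩
  have hme : m (Function.invFunOn m E (m e)) = m e := Function.invFunOn_eq ⟨e, he, rfl⟩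
  obtain ⟨u, v, hu, hv, huv⟩ := hX.exists_mul_mul_eq hA
    (g := Function.invFunOn m E (m e)) (k := e)
    fun a ha b hb => congrFun hme (⟨a, ha⟩, ⟨b, hb⟩)
  rw [← huv]
  exact Set.mul_mem_mul (Set.mul_mem_mul (hAU hu)
    (Set.mem_image_of_mem _ (Set.mem_image_of_mem _ he))) (hAU hv)

/-- The radius may depend on `A`, hence on the écart, but not on `g ∈ E`. -/
theorem isCoarselyBoundedSet (hX : IsUrysohnSpace Δ X) (h : IsDistanceSet Δ) {E : Set (X ≃ᵢ X)}
    (hE : ∀ A : Set X, A.Finite → ∃ r ∈ Δ, ∀ a ∈ A, ∀ b ∈ A,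
      dist a b ≤ 2 * r ∧ ∀ g ∈ E, dist a (g b) ≤ 2 * r) : IsCoarselyBoundedSet E := by
  intro d hd hinv
  have hU : {g : X ≃ᵢ X | d 1 g < 1} ∈ 𝓝 1 := by
    have hc : Continuous fun g : X ≃ᵢ X => d 1 g :=
      hd.comp (continuous_const.prodMk continuous_id)
    exact (isOpen_lt hc continuous_const).mem_nhds (by simp [PseudoMetric.refl])
  obtain ⟨A, hA, hAU⟩ := IsometryEquiv.exists_finite_of_mem_nhds_one hU
  obtain ⟨r, hr, hAr⟩ := hE A hA
  have hmul : ∀ g k, d 1 (g * k) ≤ d 1 g + d 1 k := fun g k => by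
    have h1 := d.triangle 1 g (g * k)
    have h2 := hinv g 1 k
    rw [mul_one] at h2
    linarith
  obtain ⟨f, hf⟩ := hX.exists_dist_apply_eq_const h hA hA hr
    (fun a ha b hb => (hAr a ha b hb).1) (fun a ha b hb => (hAr a ha b hb).1)
  have key : ∀ k : X ≃ᵢ X, (∀ a ∈ A, ∀ b ∈ A, dist a (k b) = r) → d 1 k ≤ d 1 f + 2 := by
    intro k hk
    obtain ⟨u, v, hu, hv, rfl⟩ := hX.exists_mul_mul_eq hA (g := f) (k := k)
      fun a ha b hb => by rw [hk a ha b hb, dist_comm, hf b hb a ha]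
    have h1 : d 1 u < 1 := hAU hu
    have h2 : d 1 v < 1 := hAU hv
    linarith [hmul (u * f) v, hmul u f]
  have bound : ∀ g ∈ E, d 1 g ≤ 2 * d 1 f + 4 := by
    intro g hg
    -- Placing `k A` at distance `r` from both `A` and `g A` makes `key` apply to both factors of `g
    -- = k * (k⁻¹ * g)`.
    obtain ⟨k, hk⟩ := hX.exists_dist_apply_eq_const h hA (hA.union (hA.image g)) hr
      (fun a ha b hb => (hAr a ha b hb).1) (by
        rintro _ (ha | ⟨a, ha, rfl⟩) _ (hb | ⟨b, hb, rfl⟩)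
        · exact (hAr _ ha _ hb).1
        · exact (hAr _ ha _ hb).2 g hg
        · rw [dist_comm]
          exact (hAr _ hb _ ha).2 g hg
        · rw [g.dist_eq]
          exact (hAr _ ha _ hb).1)
    have h1 := key k fun a ha b hb => by
      rw [dist_comm]
      exact hk b hb a (Or.inl ha)
    have h2 := key (k⁻¹ * g) fun a ha b hb => by
      rw [← k.dist_eq, IsometryEquiv.mul_apply, IsometryEquiv.apply_inv_self]
      exact hk a ha _ (Or.inr ⟨b, hb, rfl⟩)
    have h3 := hmul k (k⁻¹ * g)
    rw [mul_inv_cancel_left] at h3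
    linarith
  refine ⟨2 * (2 * d 1 f + 4), fun x hx y hy => ?_⟩
  linarith [d.triangle x 1 y, d.symm x 1, bound x hx, bound y hy]

theorem isLocallyBoundedGroup (hX : IsUrysohnSpace Δ X) (h : IsDistanceSet Δ) :
    IsLocallyBoundedGroup (X ≃ᵢ X) := by
  obtain ⟨x⟩ := hX.nonempty h
  refine ⟨_, IsometryEquiv.fixing_mem_nhds_one x, hX.isCoarselyBoundedSet h fun A hA => ?_⟩
  have hB : (insert x A ×ˢ insert x A).Finite := (hA.insert x).prod (hA.insert x)
  obtain ⟨⟨p, q⟩, -, hpq⟩ := Set.exists_max_image _ (fun p : X × X => dist p.1 p.2) hB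
    ⟨(x, x), by simp⟩
  have hle : ∀ a ∈ insert x A, ∀ b ∈ insert x A, dist a b ≤ dist p q :=
    fun a ha b hb => hpq (a, b) ⟨ha, hb⟩
  -- The diameter of `A ∪ {x}` is attained, hence lies in `Δ`. Passing through the fixed point `x`
  -- bounds `dist a (g b)` by twice this diameter.
  refine ⟨dist p q, hX.isDeltaMetric p q, fun a ha b hb => ⟨?_, fun g hg => ?_⟩⟩
  · linarith [hle a (Or.inr ha) b (Or.inr hb), dist_nonneg (x := p) (y := q)]
  · have h1 := dist_triangle a x (g b)
    have h2 : dist x (g b) = dist x b := by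
      nth_rewrite 1 [← show g x = x from hg]
      exact g.dist_eq x b
    linarith [hle a (Or.inr ha) x (Or.inl rfl), hle x (Or.inl rfl) b (Or.inr hb)]

theorem isCoarselyBoundedGroup_iff (hX : IsUrysohnSpace Δ X) (h : IsDistanceSet Δ) :
    IsCoarselyBoundedGroup (X ≃ᵢ X) ↔ Bornology.IsBounded Δ := by
  rw [h.isBounded_iff]
  constructor
  · intro hG
    obtain ⟨x⟩ := hX.nonempty h
    obtain ⟨C, hC⟩ := hG (IsometryEquiv.orbitPseudoMetric x)
      (IsometryEquiv.continuous_orbitPseudoMetric x) fun g k l => g.dist_eq _ _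
    refine ⟨C, fun t ht => ?_⟩
    obtain ⟨g, rfl⟩ := hX.exists_dist_apply_eq h x ht
    exact hC 1 trivial g trivial
  · intro hb
    obtain ⟨m, hm, hle⟩ := h.exists_isGreatest hb
    have hm' : ∀ x y : X, dist x y ≤ 2 * m := fun x y => by
      linarith [hle (hX.isDeltaMetric x y), h.nonneg hm]
    exact hX.isCoarselyBoundedSet h fun A _ => ⟨m, hm, fun a _ b _ => ⟨hm' _ _, fun g _ => hm' _ _⟩⟩

theorem isRoelckePrecompactGroup_iff (hX : IsUrysohnSpace Δ X) (h : IsDistanceSet Δ) :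
    IsRoelckePrecompactGroup (X ≃ᵢ X) ↔ Δ.Finite := by
  rw [IsRoelckePrecompactGroup, hX.isRoelckePrecompactSet_iff]
  constructor
  · intro hG
    obtain ⟨x⟩ := hX.nonempty h
    refine (hG x x).subset fun t ht => ?_
    obtain ⟨g, hg⟩ := hX.exists_dist_apply_eq h x ht
    exact ⟨g, trivial, hg⟩
  · intro hf x y
    refine hf.subset ?_
    rintro _ ⟨e, -, rfl⟩
    exact hX.isDeltaMetric _ _

/-- An open set contains some `g V_A`, and `V_A` moves a suitable point by every distance up to a
given bound, so finiteness passes to `Δ`. Conversely, the stabiliser of `x` moves points boundedly,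
hence by finitely many distances if `Δ` is locally finite. -/
theorem isLocallyRoelckePrecompactGroup_iff (hX : IsUrysohnSpace Δ X) (h : IsDistanceSet Δ) :
    IsLocallyRoelckePrecompactGroup (X ≃ᵢ X) ↔ IsClosed Δ ∧ IsDiscrete Δ := by
  rw [h.isClosed_and_isDiscrete_iff]
  obtain ⟨x⟩ := hX.nonempty h
  constructor
  · rintro ⟨E, hE, ⟨g, hg⟩, hEr⟩ R
    obtain ⟨A, hA, hAE⟩ := IsometryEquiv.exists_finite_of_isOpen hE hg
    obtain ⟨D, hD⟩ := ((hA.prod hA).image fun p : X × X => dist p.1 p.2).bddAbove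
    -- The single constant `s` dominates the distances within `A` and all elements of `Δ` up to `R`.
    obtain ⟨s, hs, hle⟩ := h.exists_forall_le (max R D)
    have hs0 := h.nonneg hs
    have hAs : ∀ a ∈ A, ∀ b ∈ A, dist a b ≤ 2 * s := fun a ha b hb => by
      have := hle _ (hX.isDeltaMetric a b)
        ((hD ⟨(a, b), ⟨ha, hb⟩, rfl⟩ : dist a b ≤ D).trans (le_max_right _ _))
      linarith
    obtain ⟨k, hk⟩ := hX.exists_dist_apply_eq_const h (Set.finite_singleton x) hA hs
      (by
        rintro _ rfl _ rfl
        rw [dist_self]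
        linarith) hAs
    refine ((hX.isRoelckePrecompactSet_iff.1 hEr) (g (k x)) (k x)).subset ?_
    rintro t ⟨ht, htR⟩
    have hts := hle t ht ((show t ≤ R from htR).trans (le_max_left _ _))
    obtain ⟨l, hlA, hl⟩ := hX.exists_fixing_dist_apply_eq h hA hs ht (by linarith) hAs
      (y := k x) fun a ha => hk x rfl a ha
    refine ⟨g * l, hAE _ fun a ha => ?_, ?_⟩
    · rw [IsometryEquiv.mul_apply, hlA a ha]
    · simpa only [IsometryEquiv.mul_apply, g.dist_eq] using hl
  · intro hf
    refine ⟨_, IsometryEquiv.isOpen_fixing x, ⟨1, rfl⟩, hX.isRoelckePrecompactSet_iff.2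
      fun y z => (hf (dist y x + dist x z)).subset ?_⟩
    rintro _ ⟨g, hg, rfl⟩
    refine ⟨hX.isDeltaMetric _ _, ?_⟩
    have h2 : dist x (g z) = dist x z := by
      nth_rewrite 1 [← show g x = x from hg]
      exact g.dist_eq x z
    simp only [Set.mem_Iic]
    linarith [dist_triangle y x (g z)]

end IsUrysohnSpace

theorem mainTheorem12 (Δ : Set ℝ) (hΔ : IsDistanceSet Δ)
    (X : Type*) [MetricSpace X] (hX : IsUrysohnSpace Δ X) :
    IsLocallyBoundedGroup (X ≃ᵢ X) ∧
    (IsCoarselyBoundedGroup (X ≃ᵢ X) ↔ Bornology.IsBounded Δ) ∧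
    (IsLocallyRoelckePrecompactGroup (X ≃ᵢ X) ↔ (IsClosed Δ ∧ IsDiscrete Δ)) ∧
    (IsRoelckePrecompactGroup (X ≃ᵢ X) ↔ Δ.Finite) :=
  ⟨hX.isLocallyBoundedGroup hΔ, hX.isCoarselyBoundedGroup_iff hΔ,
    hX.isLocallyRoelckePrecompactGroup_iff hΔ, hX.isRoelckePrecompactGroup_iff hΔ⟩
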